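/- Theorem. All Banach spaces are real. For a Banach space $X$, a vector $x \in X$ is an SSD-point (point of strong subdifferentiability) of $X$ if the one-sided limit $\lim_{t\to 0^+} \frac{\|x+th\|-\|x\|}{t}$ exists uniformly for $h$ in the closed unit ball of $X$. For a closed subspace $Y \subset X$ and $x \in X$, let $P_Y(x) = \{y \in Y : \|x-y\| = d(x,Y)\}$. The subspace $Y$ is proximinal in $X$ if $P_Y(x) \neq \emptyset$ for every $x \in X \setminus Y$; it is strongly proximinal in $X$ if it is proximinal and, for every $x \in X \setminus Y$ and every sequence $(y_n)$ in $Y$ with $\lim_n \|x-y_n\| = d(x,Y)$, there are a subsequence $(y_{n_k})$ and a sequence $(z_k)$ in $P_Y(x)$ with $\|y_{n_k}-z_k\| \to 0$. Let $(X_i)_{i\in I}$ be an arbitrary family of Banach spaces such that, for every $i \in I$ and every finite collection of SSD-points of the dual space $X_i^*$, the intersection of their kernels is a strongly proximinal subspace of $X_i$. Let $X = \bigoplus_{c_0} X_i$ be the $c_0$-direct sum, that is, the space of all $x = (x_i)_{i \in I} \in \prod_{i\in I} X_i$ such that $\{i \in I : \|x_i\| \geq \varepsilon\}$ is finite for every $\varepsilon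 > 0$, with the norm $\|x\| = \sup_{i} \|x_i\|$. Then, for every finite collection of SSD-points of $X^*$, the intersection of their kernels is a strongly proximinal subspace of $X$. -/

import Mathlib

open Filter Topology
open scoped ENNReal

/-- `x` is a point of strong subdifferentiability (SSD-point) of the normed space `E`: the one-sided
limit of `(‖x + t h‖ - ‖x‖) / t` as `t → 0⁺` exists uniformly for `h` in the closed unit ball. -/
def IsSSDPoint {E : Type*} [NormedAddCommGroup E] [NormedSpace ℝ E] (x : E) : Prop :=
  ∃ g : E → ℝ, TendstoUniformlyOn (fun (t : ℝ) (h : E) => (‖x + t • h‖ - ‖x‖) / t) g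
    (𝓝[>] (0 : ℝ)) (Metric.closedBall (0 : E) 1)

section Proximinality

variable {X : Type*} [NormedAddCommGroup X] [NormedSpace ℝ X]

/-- The set `P_Y(x)` of best approximations to `x` from `Y`. -/
def bestApprox (Y : Submodule ℝ X) (x : X) : Set X :=
  {y | y ∈ Y ∧ Metric.infDist x (Y : Set X) = ‖x - y‖}

/-- `Y` is a closed subspace from which every point outside `Y` has a best approximation. -/
def IsProximinal (Y : Submodule ℝ X) : Prop :=
  IsClosed (Y : Set X) ∧ ∀ x : X, x ∉ Y → (bestApprox Y x).Nonempty

/-- `Y` is proximinal and every minimizing sequence in `Y` for a point `x ∉ Y` has a subsequence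
which is asymptotic to a sequence of best approximations to `x`. -/
def IsStronglyProximinal (Y : Submodule ℝ X) : Prop :=
  IsProximinal Y ∧
    ∀ x : X, x ∉ Y → ∀ y : ℕ → X, (∀ n, y n ∈ Y) →
      Tendsto (fun n => ‖x - y n‖) atTop (𝓝 (Metric.infDist x (Y : Set X))) →
      ∃ φ : ℕ → ℕ, StrictMono φ ∧ ∃ z : ℕ → X, (∀ k, z k ∈ bestApprox Y x) ∧
        Tendsto (fun k => ‖y (φ k) - z k‖) atTop (𝓝 0)

end Proximinality

/-- The intersection of the kernels of any finitely many SSD-points of the dual space `X*` is a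
strongly proximinal subspace of `X`. -/
def SSDKernelsStronglyProximinal (X : Type*) [NormedAddCommGroup X] [NormedSpace ℝ X] : Prop :=
  ∀ S : Finset (StrongDual ℝ X), (∀ f ∈ S, IsSSDPoint f) →
    IsStronglyProximinal (⨅ f ∈ S, LinearMap.ker (f : X →ₗ[ℝ] ℝ))

section C0Sum

variable {I : Type*} (E : I → Type*) [∀ i, NormedAddCommGroup (E i)] [∀ i, NormedSpace ℝ (E i)]

/-- The `c₀`-direct sum of the spaces `E i`, as a subspace of their `ℓ_∞`-direct sum, hence with
the supremum norm: the families `x` such that `‖x i‖ ≥ ε` for only finitely many `i`, for each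
`ε > 0`. -/
def c0Sum : Submodule ℝ (lp E ∞) where
  carrier := {x | Tendsto (fun i => ‖x i‖) cofinite (𝓝 0)}
  add_mem' {x y} hx hy := by
    have hxy : Tendsto (fun i => ‖x i‖ + ‖y i‖) cofinite (𝓝 0) := by
      simpa using Tendsto.add hx hy
    exact squeeze_zero (fun i => norm_nonneg _) (fun i => norm_add_le (x i) (y i)) hxy
  zero_mem' := by simpa using tendsto_const_nhds
  smul_mem' c x hx := by
    have hcx : Tendsto (fun i => ‖c‖ * ‖x i‖) cofinite (𝓝 0) := by
      simpa using Tendsto.const_mul ‖c‖ hx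
    exact hcx.congr fun i => (norm_smul c (x i)).symm

theorem isClosed_c0Sum : IsClosed (c0Sum E : Set (lp E ∞)) := by
  refine isClosed_of_closure_subset fun x hx => ?_
  change Tendsto (fun i => ‖x i‖) cofinite (𝓝 0)
  rw [Metric.tendsto_nhds]
  intro ε hε
  obtain ⟨y, hy, hxy⟩ := Metric.mem_closure_iff.1 hx (ε / 2) (half_pos hε)
  have hy' : Tendsto (fun i => ‖y i‖) cofinite (𝓝 0) := hy
  filter_upwards [Metric.tendsto_nhds.1 hy' (ε / 2) (half_pos hε)] with i hi
  have h1 : ‖x i - y i‖ ≤ ‖x - y‖ := lp.norm_apply_le_norm ENNReal.top_ne_zero (x - y) i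
  have h2 : ‖x i‖ ≤ ‖x i - y i‖ + ‖y i‖ := norm_le_norm_sub_add _ _
  rw [dist_eq_norm] at hxy
  simp only [dist_zero_right, norm_norm] at hi ⊢
  linarith

instance c0Sum_completeSpace [∀ i, CompleteSpace (E i)] : CompleteSpace (c0Sum E) :=
  (isClosed_c0Sum E).completeSpace_coe

end C0Sum

/-! Norms on the dual of a `c₀`-sum add over a summand and its complement, as in an `ℓ₁`-sum
(`norm_add_comp_proj`). Hence each component of an SSD-point is an SSD-point, and only finitely many
are nonzero: along the direction that cancels a tiny component, the norm falls and then returns,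
which uniform convergence forbids. Finitely many SSD-points thus form a finite-rank operator `T` on
finitely many summands, whose restrictions have strongly proximinal kernels. Let `T (u n) = T x`
with `‖u n‖ → d`. By compactness in finite dimension, the contributions of the summands converge
along a subsequence, to values `v j` with sum `T x`. Each coordinate of `u n` then almost solves a
problem with fixed right-hand side `v j` and norm bound `d`, so `exists_solution_near` supplies a
nearby exact solution. The remaining coordinates are scaled into the ball of radius `d`, and the
pieces glue because the norm is a supremum. -/

/-! ### Stability of norm-constrained solutions in one space. -/

section StrongProximinality

variable {X : Type*} [NormedAddCommGroup X] [NormedSpace ℝ X]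

/-- The `ε`-`δ` form of strong proximinality. -/
theorem IsStronglyProximinal.exists_bestApprox_near {Y : Submodule ℝ X}
    (hY : IsStronglyProximinal Y) {x : X} (hx : x ∉ Y) {ε : ℝ} (hε : 0 < ε) :
    ∃ δ > 0, ∀ y ∈ Y, ‖x - y‖ < Metric.infDist x (Y : Set X) + δ →
      ∃ z ∈ bestApprox Y x, ‖y - z‖ < ε := by
  by_contra! h
  choose y hyY hy hfar using fun n : ℕ => h (1 / ((n : ℝ) + 1)) Nat.one_div_pos_of_nat
  have hlim : Tendsto (fun n => ‖x - y n‖) atTop (𝓝 (Metric.infDist x (Y : Set X))) := by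
    refine tendsto_of_tendsto_of_tendsto_of_le_of_le tendsto_const_nhds
      (by simpa using tendsto_const_nhds.add (tendsto_one_div_add_atTop_nhds_zero_nat (𝕜 := ℝ)))
      (fun n => ?_) (fun n => (hy n).le)
    simpa [dist_eq_norm] using Metric.infDist_le_dist_of_mem (x := x) (hyY n)
  obtain ⟨φ, -, z, hz, hzlim⟩ := hY.2 x hx y hyY hlim
  obtain ⟨k, hk⟩ := (hzlim.eventually (gt_mem_nhds hε)).exists
  exact absurd hk (not_lt.2 (hfar (φ k) (z k) (hz k)))

/-- Points of a strongly proximinal subspace at distance almost at most `d` from `x` are close to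
points of the subspace at distance at most `d` from `x`. -/
theorem IsStronglyProximinal.exists_norm_sub_le_near {Y : Submodule ℝ X}
    (hY : IsStronglyProximinal Y) (x : X) {d : ℝ} (hd : 0 < d) {ε : ℝ} (hε : 0 < ε) :
    ∃ δ > 0, ∀ y ∈ Y, ‖x - y‖ < d + δ → ∃ z ∈ Y, ‖x - z‖ ≤ d ∧ ‖y - z‖ < ε := by
  -- Below the distance the claim is vacuous, at the distance it is strong proximinality, and above
  -- it convexity suffices: move `y` towards a point `q` of `Y` at distance less than `d`.
  rcases lt_trichotomy d (Metric.infDist x (Y : Set X)) with h | h | h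
  · refine ⟨_, sub_pos.2 h, fun y hy hxy => ?_⟩
    have := Metric.infDist_le_dist_of_mem (x := x) (s := (Y : Set X)) hy
    rw [dist_eq_norm] at this
    linarith
  · have hx : x ∉ Y := fun hx => by
      rw [Metric.infDist_zero_of_mem (show x ∈ (Y : Set X) from hx)] at h
      exact hd.ne' h
    obtain ⟨δ, hδ, H⟩ := hY.exists_bestApprox_near hx hε
    refine ⟨δ, hδ, fun y hy hxy => ?_⟩
    obtain ⟨z, hz, hyz⟩ := H y hy (h ▸ hxy)
    exact ⟨z, hz.1, by rw [h, hz.2], hyz⟩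
  · obtain ⟨q, hq, hxq⟩ := (Metric.infDist_lt_iff ⟨0, Y.zero_mem⟩).1 h
    rw [dist_eq_norm] at hxq
    set s := ‖x - q‖ with hs
    have hs0 : 0 ≤ s := norm_nonneg _
    have hds : 0 < d - s := sub_pos.2 hxq
    set M := (2 * d + 1) / (d - s) with hM
    have hM0 : 0 < M := by positivity
    refine ⟨min 1 (ε / 2 / M), by positivity, fun y hy hxy => ?_⟩
    set η := min 1 (ε / 2 / M) with hη
    have hη0 : 0 < η := by positivity
    have hη1 : η ≤ 1 := min_le_left _ _
    have hηM : η * M ≤ ε / 2 := (le_div_iff₀ hM0).1 (min_le_right _ _)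
    -- The weight solving `(1 - l) * (d + η) + l * s = d`.
    set l := η / (d - s + η) with hl
    have hden : 0 < d - s + η := by linarith
    have hl0 : 0 ≤ l := by positivity
    have hl1 : l ≤ 1 := (div_le_one hden).2 (by linarith)
    have hlmul : l * (d - s + η) = η := div_mul_cancel₀ _ hden.ne'
    refine ⟨(1 - l) • y + l • q, Y.add_mem (Y.smul_mem _ hy) (Y.smul_mem _ hq), ?_, ?_⟩
    · have e : x - ((1 - l) • y + l • q) = (1 - l) • (x - y) + l • (x - q) := by module
      calc ‖x - ((1 - l) • y + l • q)‖ ≤ (1 - l) * ‖x - y‖ + l * s := by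
            rw [e]
            refine (norm_add_le _ _).trans_eq ?_
            rw [norm_smul, norm_smul, Real.norm_of_nonneg hl0,
              Real.norm_of_nonneg (sub_nonneg.2 hl1)]
        _ ≤ (1 - l) * (d + η) + l * s := by
            have := sub_nonneg.2 hl1
            gcongr
        _ = d + η - l * (d - s + η) := by ring
        _ = d := by rw [hlmul]; ring
    · have e : y - ((1 - l) • y + l • q) = l • ((x - q) - (x - y)) := by module
      have hle : l ≤ η / (d - s) := by
        rw [hl]; gcongr; linarith
      calc ‖y - ((1 - l) • y + l • q)‖ = l * ‖(x - q) - (x - y)‖ := by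
            rw [e, norm_smul, Real.norm_of_nonneg hl0]
        _ ≤ η / (d - s) * (2 * d + 1) := by
            refine mul_le_mul hle ?_ (norm_nonneg _) (by positivity)
            have := norm_sub_le (x - q) (x - y)
            linarith
        _ = η * M := by rw [hM]; ring
        _ < ε := by linarith

variable {F : Type*} [NormedAddCommGroup F] [NormedSpace ℝ F] [FiniteDimensional ℝ F]

/-- A finite-rank operator has preimages with a linear norm bound. -/
theorem ContinuousLinearMap.exists_preimage_norm_le_of_finiteDimensional (T : X →L[ℝ] F) :
    ∃ C > 0, ∀ u, ∃ p, T p = T u ∧ ‖p‖ ≤ C * ‖T u‖ := by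
  -- A linear section over the range is automatically bounded, the range being finite-dimensional.
  obtain ⟨g, hg⟩ := (T : X →ₗ[ℝ] F).rangeRestrict.exists_rightInverse_of_surjective
    (LinearMap.range_rangeRestrict _)
  set G := LinearMap.toContinuousLinearMap g
  refine ⟨‖G‖ + 1, by positivity, fun u => ⟨g ⟨T u, u, rfl⟩, ?_, ?_⟩⟩
  · exact congrArg Subtype.val (LinearMap.congr_fun hg ⟨T u, u, rfl⟩)
  · calc ‖g ⟨T u, u, rfl⟩‖ ≤ ‖G‖ * ‖T u‖ := G.le_opNorm ⟨T u, u, rfl⟩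
      _ ≤ (‖G‖ + 1) * ‖T u‖ := by gcongr; linarith

/-- If the kernel of a finite-rank operator `T` is strongly proximinal, then approximate solutions
of `T w = v`, `‖w‖ ≤ d` are close to exact solutions. -/
theorem IsStronglyProximinal.exists_solution_near {T : X →L[ℝ] F}
    (hT : IsStronglyProximinal (LinearMap.ker (T : X →ₗ[ℝ] F))) (v : F) {d : ℝ} (hd : 0 < d)
    {ε : ℝ} (hε : 0 < ε) :
    ∃ δ > 0, ∀ u, ‖T u - v‖ < δ → ‖u‖ < d + δ → ∃ w, T w = v ∧ ‖w‖ ≤ d ∧ ‖u - w‖ < ε := by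
  by_cases hv : v ∈ LinearMap.range (T : X →ₗ[ℝ] F)
  · obtain ⟨x, rfl⟩ := hv
    obtain ⟨η, hη, H⟩ := hT.exists_norm_sub_le_near x hd (half_pos hε)
    obtain ⟨C, hC, hCT⟩ := T.exists_preimage_norm_le_of_finiteDimensional
    set η' := min η (ε / 2)
    have hη' : 0 < η' := by positivity
    have hmul : η' / (C + 1) * (C + 1) = η' := div_mul_cancel₀ _ (by positivity)
    -- Correcting `u` by `p` makes the equation exact at a cost of at most `C * δ` in norm, and `δ +
    -- C * δ = η'`.
    refine ⟨η' / (C + 1), by positivity, fun u hu hud => ?_⟩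
    set δ := η' / (C + 1)
    have hδ : 0 < δ := by positivity
    obtain ⟨p, hp, hpC⟩ := hCT (u - x)
    have hpn : ‖p‖ ≤ C * δ := hpC.trans (by
      rw [map_sub]; exact mul_le_mul_of_nonneg_left hu.le hC.le)
    obtain ⟨z, hz, hxz, hyz⟩ := H (x - (u - p)) (by
        simp [hp]) (by
        rw [sub_sub_cancel]
        have := norm_sub_le u p
        have : η' ≤ η := min_le_left _ _
        linarith)
    refine ⟨x - z, ?_, hxz, ?_⟩
    · have : T z = 0 := hz
      simp [this]
    · have e : u - (x - z) = p - (x - (u - p) - z) := by abel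
      rw [e]
      have := norm_sub_le p (x - (u - p) - z)
      have : η' ≤ ε / 2 := min_le_right _ _
      linarith
  · have hcl : IsClosed (LinearMap.range (T : X →ₗ[ℝ] F) : Set F) :=
      Submodule.closed_of_finiteDimensional _
    obtain ⟨δ, hδ, H⟩ := Metric.isOpen_iff.1 hcl.isOpen_compl v hv
    refine ⟨δ, hδ, fun u hu _ => absurd ⟨u, rfl⟩ (H (a := T u) ?_)⟩
    rwa [Metric.mem_ball, dist_eq_norm]

end StrongProximinality

/-! ### Coordinates of the `c₀`-sum and SSD-points of its dual. -/

section C0SumCoordinates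

open Classical in
/-- The inclusion of a summand in the `c₀`-direct sum. -/
noncomputable def c0Sum.incl {I : Type*} (E : I → Type*) [∀ i, NormedAddCommGroup (E i)]
    [∀ i, NormedSpace ℝ (E i)] (i : I) : E i →L[ℝ] c0Sum E :=
  (lp.singleContinuousLinearMap ℝ E ∞ i).codRestrict (c0Sum E) fun a => by
    refine tendsto_const_nhds.congr' ?_
    filter_upwards [(Set.finite_singleton i).compl_mem_cofinite] with j hj
    have hji : j ≠ i := hj
    simp [hji]

/-- The projection of the `c₀`-direct sum onto a summand. -/
noncomputable def c0Sum.proj {I : Type*} (E : I → Type*) [∀ i, NormedAddCommGroup (E i)]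
    [∀ i, NormedSpace ℝ (E i)] (i : I) : c0Sum E →L[ℝ] E i :=
  LinearMap.mkContinuous
    { toFun := fun x => (x : lp E ∞) i
      map_add' := fun _ _ => rfl
      map_smul' := fun _ _ => rfl } 1
    fun x => by
      rw [one_mul]; exact lp.norm_apply_le_norm ENNReal.top_ne_zero (x : lp E ∞) i

variable {I : Type*} {E : I → Type*} [∀ i, NormedAddCommGroup (E i)] [∀ i, NormedSpace ℝ (E i)]

namespace c0Sum

@[simp]
theorem proj_incl_self (i : I) (a : E i) : proj E i (incl E i a) = a := by
  classical exact lp.single_apply_self ∞ i a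

theorem proj_incl_of_ne {i j : I} (h : j ≠ i) (a : E i) : proj E j (incl E i a) = 0 := by
  classical exact lp.single_apply_ne ∞ i a h

theorem norm_proj_apply_le (i : I) (x : c0Sum E) : ‖proj E i x‖ ≤ ‖x‖ :=
  lp.norm_apply_le_norm ENNReal.top_ne_zero (x : lp E ∞) i

theorem norm_proj_le (i : I) : ‖proj E i‖ ≤ 1 :=
  ContinuousLinearMap.opNorm_le_bound _ zero_le_one fun x => by
    rw [one_mul]; exact norm_proj_apply_le i x

theorem norm_le_of_forall_le {x : c0Sum E} {C : ℝ} (hC : 0 ≤ C) (h : ∀ i, ‖proj E i x‖ ≤ C) :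
    ‖x‖ ≤ C :=
  lp.norm_le_of_forall_le (f := (x : lp E ∞)) hC h

theorem norm_incl (i : I) (a : E i) : ‖incl E i a‖ = ‖a‖ := by
  classical exact lp.norm_single ENNReal.zero_lt_top i a

theorem tendsto_norm_proj (x : c0Sum E) : Tendsto (fun i => ‖proj E i x‖) cofinite (𝓝 0) := x.2

open Classical in
theorem proj_sum_incl (J : Finset I) (a : ∀ i, E i) (i : I) :
    proj E i (∑ j ∈ J, incl E j (a j)) = if i ∈ J then a i else 0 := by
  rw [map_sum]
  split_ifs with h
  · rw [Finset.sum_eq_single_of_mem i h fun j _ hj => proj_incl_of_ne hj.symm _, proj_incl_self]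
  · exact Finset.sum_eq_zero fun j hj => proj_incl_of_ne (ne_of_mem_of_not_mem hj h).symm _

variable {F : Type*} [NormedAddCommGroup F] [NormedSpace ℝ F]

/-- An operator on the `c₀`-direct sum that vanishes on the summands is zero. -/
theorem eq_zero_of_comp_incl {f : c0Sum E →L[ℝ] F} (hf : ∀ i, f.comp (incl E i) = 0) : f = 0 := by
  classical
  refine ContinuousLinearMap.ext fun x => ?_
  refine norm_le_zero_iff.1 (le_of_forall_pos_le_add fun ε hε => ?_)
  have hε' : 0 < ε / (‖f‖ + 1) := by positivity
  have hfin := (tendsto_norm_proj x).eventually (gt_mem_nhds hε')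
  rw [eventually_cofinite] at hfin
  set J := hfin.toFinset
  have hz : f (∑ j ∈ J, incl E j (proj E j x)) = 0 := by
    rw [map_sum]
    exact Finset.sum_eq_zero fun j _ => DFunLike.congr_fun (hf j) _
  have hn : ‖x - ∑ j ∈ J, incl E j (proj E j x)‖ ≤ ε / (‖f‖ + 1) := by
    refine norm_le_of_forall_le hε'.le fun i => ?_
    rw [map_sub, proj_sum_incl]
    split_ifs with h
    · simpa using hε'.le
    · rw [sub_zero]
      by_contra h'
      exact h (hfin.mem_toFinset.2 fun h'' => h' (le_of_lt h''))
  have h1 := f.le_opNorm_of_le hn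
  rw [map_sub, hz, sub_zero] at h1
  rw [zero_add]
  refine h1.trans ?_
  rw [mul_div_assoc', div_le_iff₀ (by positivity)]
  nlinarith [norm_nonneg f]

/-- An operator supported on finitely many summands is the sum of its components. -/
theorem apply_eq_sum {f : c0Sum E →L[ℝ] F} {J : Finset I}
    (hf : ∀ i ∉ J, f.comp (incl E i) = 0) (x : c0Sum E) :
    f x = ∑ j ∈ J, f (incl E j (proj E j x)) := by
  classical
  have h : f - ∑ j ∈ J, (f.comp (incl E j)).comp (proj E j) = 0 := by
    refine eq_zero_of_comp_incl fun i => ?_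
    refine ContinuousLinearMap.ext fun a => ?_
    simp only [ContinuousLinearMap.comp_apply, sub_apply,
      sum_apply, zero_apply]
    by_cases hi : i ∈ J
    · rw [Finset.sum_eq_single_of_mem i hi fun j _ hj => by rw [proj_incl_of_ne hj]; simp]
      simp
    · rw [Finset.sum_eq_zero fun j hj => by
        rw [proj_incl_of_ne (ne_of_mem_of_not_mem hj hi)]; simp]
      simpa using DFunLike.congr_fun (hf i hi) a
  have := DFunLike.congr_fun h x
  simpa [sub_eq_zero] using this

theorem norm_comp_proj_le (i : I) (g : StrongDual ℝ (E i)) : ‖g.comp (proj E i)‖ ≤ ‖g‖ :=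
  (ContinuousLinearMap.opNorm_comp_le _ _).trans
    (mul_le_of_le_one_right (norm_nonneg _) (norm_proj_le i))

theorem _root_.StrongDual.exists_lt_apply_of_lt_norm {X : Type*} [NormedAddCommGroup X]
    [NormedSpace ℝ X] (f : StrongDual ℝ X) {r : ℝ} (hr : r < ‖f‖) : ∃ x, ‖x‖ ≤ 1 ∧ r < f x := by
  obtain ⟨x, hx, hrx⟩ := f.exists_lt_apply_of_lt_opNorm hr
  rw [Real.norm_eq_abs] at hrx
  rcases abs_choice (f x) with h | h
  · exact ⟨x, hx.le, h ▸ hrx⟩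
  · exact ⟨-x, by rw [norm_neg]; exact hx.le, by rw [map_neg]; exact h ▸ hrx⟩

/-- The dual norm of the `c₀`-direct sum is additive over a summand and its complement. -/
theorem norm_add_comp_proj {i : I} {f : StrongDual ℝ (c0Sum E)} (hf : f.comp (incl E i) = 0)
    (g : StrongDual ℝ (E i)) : ‖f + g.comp (proj E i)‖ = ‖f‖ + ‖g‖ := by
  refine le_antisymm ((norm_add_le f (g.comp (proj E i))).trans
    (add_le_add le_rfl (norm_comp_proj_le i g))) ?_
  refine le_of_forall_pos_lt_add fun ε hε => ?_
  obtain ⟨u, hu, hfu⟩ := f.exists_lt_apply_of_lt_norm (sub_lt_self ‖f‖ (half_pos hε))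
  obtain ⟨a, ha, hga⟩ := g.exists_lt_apply_of_lt_norm (sub_lt_self ‖g‖ (half_pos hε))
  have h0 (b : E i) : f (incl E i b) = 0 := DFunLike.congr_fun hf b
  -- Replacing the coordinate `i` of `u` by `a` stays in the unit ball and does not change `f`, so
  -- both norms are nearly attained at once.
  have hn : ‖u + incl E i (a - proj E i u)‖ ≤ 1 := by
    refine norm_le_of_forall_le zero_le_one fun j => ?_
    rw [map_add]
    rcases eq_or_ne j i with rfl | hj
    · simpa using ha
    · rw [proj_incl_of_ne hj, add_zero]
      exact (norm_proj_apply_le j u).trans hu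
  have h1 := (f + g.comp (proj E i)).le_opNorm_of_le hn
  have h2 : (f + g.comp (proj E i)) (u + incl E i (a - proj E i u)) = f u + g a := by
    simp [h0]
  rw [h2, mul_one] at h1
  linarith [le_abs_self (f u + g a), Real.norm_eq_abs (f u + g a)]

/-- Removing the component at `i` leaves an `F` to which `norm_add_comp_proj` applies twice; `‖F‖`
cancels. Difference quotients in the big dual thereby reduce to those in one summand. -/
theorem norm_add_comp_proj_sub_norm (f : StrongDual ℝ (c0Sum E)) (i : I)
    (g : StrongDual ℝ (E i)) :
    ‖f + g.comp (proj E i)‖ - ‖f‖ = ‖f.comp (incl E i) + g‖ - ‖f.comp (incl E i)‖ := by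
  set F := f - (f.comp (incl E i)).comp (proj E i) with hF
  have h0 : F.comp (incl E i) = 0 := by ext a; simp [hF]
  have h1 := norm_add_comp_proj h0 (f.comp (incl E i) + g)
  have h2 := norm_add_comp_proj h0 (f.comp (incl E i))
  have e1 : F + (f.comp (incl E i) + g).comp (proj E i) = f + g.comp (proj E i) := by
    rw [hF, ContinuousLinearMap.add_comp]; abel
  have e2 : F + (f.comp (incl E i)).comp (proj E i) = f := by rw [hF]; abel
  rw [e1] at h1
  rw [e2] at h2
  linarith

/-- Deleting one component lowers the norm by exactly the norm of that component; induct on `J`. -/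
theorem sum_norm_comp_incl_le (f : StrongDual ℝ (c0Sum E)) (J : Finset I) :
    ∑ j ∈ J, ‖f.comp (incl E j)‖ ≤ ‖f‖ := by
  classical
  induction J using Finset.induction_on generalizing f with
  | empty => rw [Finset.sum_empty]; exact norm_nonneg f
  | insert i J hi ih =>
    have h1 := norm_add_comp_proj_sub_norm f i (-f.comp (incl E i))
    rw [add_neg_cancel, norm_zero, zero_sub] at h1
    have h2 := ih (f + (-f.comp (incl E i)).comp (proj E i))
    have h3 : ∑ j ∈ J, ‖(f + (-f.comp (incl E i)).comp (proj E i)).comp (incl E j)‖ =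
        ∑ j ∈ J, ‖f.comp (incl E j)‖ := by
      refine Finset.sum_congr rfl fun j hj => ?_
      congr 1
      ext a
      have hij : i ≠ j := fun e => hi (e ▸ hj)
      simp [proj_incl_of_ne hij]
    rw [Finset.sum_insert hi]
    linarith

end c0Sum

/-- The components of an SSD-point of the dual of a `c₀`-direct sum are SSD-points. -/
theorem IsSSDPoint.comp_incl {f : StrongDual ℝ (c0Sum E)} (hf : IsSSDPoint f) (i : I) :
    IsSSDPoint (f.comp (c0Sum.incl E i)) := by
  obtain ⟨g, hg⟩ := hf
  refine ⟨fun h => g (h.comp (c0Sum.proj E i)), ?_⟩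
  refine ((hg.comp fun h : StrongDual ℝ (E i) => h.comp (c0Sum.proj E i)).mono
    fun h hh => ?_).congr (Eventually.of_forall fun t h _ => ?_)
  · exact (mem_closedBall_zero_iff (a := h.comp (c0Sum.proj E i))).2
      ((c0Sum.norm_comp_proj_le i h).trans (mem_closedBall_zero_iff.1 hh))
  · simp only [Function.comp_apply]
    rw [← c0Sum.norm_add_comp_proj_sub_norm, ContinuousLinearMap.smul_comp]

/-- An SSD-point of the dual of a `c₀`-direct sum has only finitely many nonzero components. -/
theorem IsSSDPoint.finite_comp_incl_ne_zero {f : StrongDual ℝ (c0Sum E)} (hf : IsSSDPoint f) :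
    {i | f.comp (c0Sum.incl E i) ≠ 0}.Finite := by
  obtain ⟨g, hg⟩ := hf
  have hev := Metric.tendstoUniformlyOn_iff.1 hg (1 / 2) one_half_pos
  obtain ⟨r, hr, hev⟩ := mem_nhdsGT_iff_exists_Ioo_subset.1 hev
  have hr : (0 : ℝ) < r := hr
  -- In the direction cancelling a component `a`, the difference quotient is `-1` at `t = ‖a‖` and
  -- `0` at `t = 2 * ‖a‖`. If both times lie below `r`, both values are within `1 / 2` of the same
  -- limit, which is impossible.
  have hlow : ∀ i, f.comp (c0Sum.incl E i) ≠ 0 → r / 2 ≤ ‖f.comp (c0Sum.incl E i)‖ := by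
    intro i hi
    by_contra! hlt
    set a := f.comp (c0Sum.incl E i) with ha
    have hapos : 0 < ‖a‖ := norm_pos_iff.2 hi
    set h := (-‖a‖⁻¹ • a).comp (c0Sum.proj E i) with hh
    have hhn : h ∈ Metric.closedBall (0 : StrongDual ℝ (c0Sum E)) 1 := by
      refine (mem_closedBall_zero_iff (a := h)).2 ((c0Sum.norm_comp_proj_le i _).trans ?_)
      rw [norm_smul, norm_neg, norm_inv, norm_norm, inv_mul_cancel₀ hapos.ne']
    have hq (t : ℝ) : ‖f + t • h‖ - ‖f‖ = |1 - t * ‖a‖⁻¹| * ‖a‖ - ‖a‖ := by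
      rw [hh, ← ContinuousLinearMap.smul_comp, c0Sum.norm_add_comp_proj_sub_norm, ← ha,
        ← Real.norm_eq_abs, ← norm_smul]
      congr 2
      module
    have h1 := hev (a := ‖a‖) ⟨hapos, by linarith⟩ h hhn
    have h2 := hev (a := 2 * ‖a‖) ⟨by positivity, by linarith⟩ h hhn
    rw [hq, mul_inv_cancel₀ hapos.ne', sub_self, abs_zero, zero_mul, zero_sub,
      neg_div_self hapos.ne', Real.dist_eq] at h1
    rw [hq, mul_assoc, mul_inv_cancel₀ hapos.ne', show |(1 : ℝ) - 2 * 1| = 1 by norm_num, one_mul,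
      sub_self, zero_div, Real.dist_eq] at h2
    rw [abs_lt] at h1 h2
    linarith [h1.2, h2.1]
  by_contra hinf
  obtain ⟨n, hn⟩ := exists_nat_gt (‖f‖ / (r / 2))
  obtain ⟨J, hJ, hJn⟩ := Set.Infinite.exists_subset_card_eq hinf n
  have h1 := c0Sum.sum_norm_comp_incl_le f J
  have h2 := Finset.card_nsmul_le_sum J (fun j => ‖f.comp (c0Sum.incl E j)‖) (r / 2)
    fun j hj => hlow j (hJ hj)
  rw [hJn, nsmul_eq_mul] at h2
  rw [div_lt_iff₀ (by positivity)] at hn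
  linarith

end C0SumCoordinates

/-! ### Gluing solutions across summands. -/

section KernelsInC0Sum

variable {I : Type*} {E : I → Type*} [∀ i, NormedAddCommGroup (E i)] [∀ i, NormedSpace ℝ (E i)]

/-- If almost minimal solutions of `T w = T x` lie, along a subsequence, close to minimal ones, then
the kernel of `T` is strongly proximinal. -/
theorem isStronglyProximinal_ker_of_forall_seq {X F : Type*} [NormedAddCommGroup X]
    [NormedSpace ℝ X] [NormedAddCommGroup F] [NormedSpace ℝ F] (T : X →L[ℝ] F)
    (h : ∀ (x : X) (d : ℝ), 0 < d → ∀ u : ℕ → X, (∀ n, T (u n) = T x) →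
      Tendsto (fun n => ‖u n‖) atTop (𝓝 d) → ∃ φ : ℕ → ℕ, StrictMono φ ∧
        ∀ ε > 0, ∀ᶠ n in atTop, ∃ w, T w = T x ∧ ‖w‖ ≤ d ∧ ‖u (φ n) - w‖ < ε) :
    IsStronglyProximinal (LinearMap.ker (T : X →ₗ[ℝ] F)) := by
  set Y := LinearMap.ker (T : X →ₗ[ℝ] F)
  have hYcl : IsClosed (Y : Set X) := T.isClosed_ker
  have key : ∀ x : X, x ∉ Y → ∀ y : ℕ → X, (∀ n, y n ∈ Y) →
      Tendsto (fun n => ‖x - y n‖) atTop (𝓝 (Metric.infDist x (Y : Set X))) →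
      ∃ φ : ℕ → ℕ, StrictMono φ ∧ ∃ z : ℕ → X, (∀ k, z k ∈ bestApprox Y x) ∧
        Tendsto (fun k => ‖y (φ k) - z k‖) atTop (𝓝 0) := by
    intro x hx y hy hlim
    have hd : 0 < Metric.infDist x (Y : Set X) :=
      (hYcl.notMem_iff_infDist_pos ⟨0, Y.zero_mem⟩).1 hx
    obtain ⟨φ, hφ, H⟩ := h x _ hd (fun n => x - y n)
      (fun n => by have : T (y n) = 0 := hy n; rw [map_sub, this, sub_zero]) hlim
    have hbest : ∀ w, T w = T x → ‖w‖ ≤ Metric.infDist x (Y : Set X) → x - w ∈ bestApprox Y x := by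
      intro w hw hwn
      have hmem : x - w ∈ Y := by simp [Y, hw]
      refine ⟨hmem, ?_⟩
      have := Metric.infDist_le_dist_of_mem (x := x) (s := (Y : Set X)) hmem
      rw [dist_eq_norm] at this
      refine le_antisymm this ?_
      rwa [sub_sub_cancel]
    have hne : (bestApprox Y x).Nonempty := by
      obtain ⟨n, w, hw, hwn, -⟩ := (H 1 one_pos).exists
      exact ⟨_, hbest w hw hwn⟩
    -- The solutions in `H` depend on `ε`; choosing `z k` within `1 / (k + 1)` of the optimal
    -- distance to the best approximations gives one sequence for all `ε`.
    choose z hz hzd using fun k : ℕ => (Metric.infDist_lt_iff hne).1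
      (lt_add_of_pos_right (Metric.infDist (y (φ k)) (bestApprox Y x))
        (Nat.one_div_pos_of_nat (α := ℝ) (n := k)))
    refine ⟨φ, hφ, z, hz, ?_⟩
    have hdist : Tendsto (fun k => Metric.infDist (y (φ k)) (bestApprox Y x)) atTop (𝓝 0) := by
      rw [Metric.tendsto_nhds]
      intro ε hε
      filter_upwards [H ε hε] with k hk
      obtain ⟨w, hw, hwn, hwε⟩ := hk
      rw [Real.dist_0_eq_abs, abs_of_nonneg Metric.infDist_nonneg]
      refine (Metric.infDist_le_dist_of_mem (hbest w hw hwn)).trans_lt ?_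
      rwa [dist_eq_norm, ← norm_neg, show -(y (φ k) - (x - w)) = x - y (φ k) - w by abel]
    refine squeeze_zero (fun _ => norm_nonneg _) (fun k => ?_)
      (by simpa only [add_zero] using hdist.add (tendsto_one_div_add_atTop_nhds_zero_nat (𝕜 := ℝ)))
    rw [← dist_eq_norm]
    exact (hzd k).le
  refine ⟨⟨hYcl, fun x hx => ?_⟩, key⟩
  choose y hy hyd using fun n : ℕ => (Metric.infDist_lt_iff ⟨0, Y.zero_mem⟩).1
    (lt_add_of_pos_right (Metric.infDist x (Y : Set X)) (Nat.one_div_pos_of_nat (α := ℝ) (n := n)))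
  -- Proximinality is itself a consequence of `key`, applied to any minimizing sequence.
  obtain ⟨-, -, z, hz, -⟩ := key x hx y hy (by
    refine tendsto_of_tendsto_of_tendsto_of_le_of_le tendsto_const_nhds
      (by simpa using tendsto_const_nhds.add (tendsto_one_div_add_atTop_nhds_zero_nat (𝕜 := ℝ)))
      (fun n => ?_) (fun n => ?_)
    · simpa [dist_eq_norm] using Metric.infDist_le_dist_of_mem (x := x) (hy n)
    · simpa [dist_eq_norm] using (hyd n).le)
  exact ⟨z 0, hz 0⟩

/-- Radial projection onto the ball of radius `d` moves `u` by at most `max d ‖u‖ - d`. -/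
theorem norm_sub_smul_div_max_le {X : Type*} [NormedAddCommGroup X] [NormedSpace ℝ X] (a : X)
    {d r : ℝ} (hd : 0 < d) (ha : ‖a‖ ≤ max d r) :
    ‖(d / max d r) • a‖ ≤ d ∧ ‖a - (d / max d r) • a‖ ≤ max d r - d := by
  set m := max d r
  have hdm : d ≤ m := le_max_left _ _
  have hm : 0 < m := hd.trans_le hdm
  have hc : d / m ≤ 1 := (div_le_one hm).2 hdm
  constructor
  · rw [norm_smul, Real.norm_of_nonneg (by positivity)]
    calc d / m * ‖a‖ ≤ d / m * m := by gcongr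
      _ = d := div_mul_cancel₀ _ hm.ne'
  · have e : a - (d / m) • a = (1 - d / m) • a := by module
    rw [e, norm_smul, Real.norm_of_nonneg (sub_nonneg.2 hc)]
    calc (1 - d / m) * ‖a‖ ≤ (1 - d / m) * m := mul_le_mul_of_nonneg_left ha (sub_nonneg.2 hc)
      _ = m - d := by rw [sub_mul, one_mul, div_mul_cancel₀ _ hm.ne']

/-- A finite-rank operator on a `c₀`-direct sum that lives on finitely many summands has strongly
proximinal kernel if its restrictions to these summands have. -/
theorem isStronglyProximinal_ker_of_finite {F : Type*} [NormedAddCommGroup F] [NormedSpace ℝ F]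
    [FiniteDimensional ℝ F] (T : c0Sum E →L[ℝ] F) {J : Finset I}
    (hJ : ∀ i ∉ J, T.comp (c0Sum.incl E i) = 0)
    (hT : ∀ i ∈ J, IsStronglyProximinal
      (LinearMap.ker (T.comp (c0Sum.incl E i) : E i →ₗ[ℝ] F))) :
    IsStronglyProximinal (LinearMap.ker (T : c0Sum E →ₗ[ℝ] F)) := by
  classical
  refine isStronglyProximinal_ker_of_forall_seq T fun x d hd u hu hlim => ?_
  let V : c0Sum E → (J → F) := fun w j => T (c0Sum.incl E j (c0Sum.proj E j w))
  have hTV (w : c0Sum E) : T w = ∑ j, V w j := by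
    rw [c0Sum.apply_eq_sum hJ, ← Finset.sum_coe_sort]
  obtain ⟨R, hR⟩ := hlim.bddAbove_range
  have hbdd : Bornology.IsBounded (Set.range fun n => V (u n)) := by
    refine isBounded_iff_forall_norm_le.2 ⟨‖T‖ * R, ?_⟩
    rintro _ ⟨n, rfl⟩
    have hn : ‖u n‖ ≤ R := hR ⟨n, rfl⟩
    have hR0 : 0 ≤ R := (norm_nonneg _).trans hn
    refine (pi_norm_le_iff_of_nonneg (by positivity)).2 fun j => T.le_opNorm_of_le ?_
    rw [c0Sum.norm_incl]
    exact (c0Sum.norm_proj_apply_le _ _).trans hn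
  -- Only the total `T (u n)` is fixed; passing to a subsequence makes its distribution among the
  -- summands converge, and `φ` does not depend on `ε`.
  obtain ⟨v, -, φ, hφ, hv⟩ := tendsto_subseq_of_bounded hbdd (x := fun n => V (u n))
    fun n => ⟨n, rfl⟩
  have hvsum : ∑ j, v j = T x := by
    refine tendsto_nhds_unique (tendsto_finsetSum _ fun j _ => tendsto_pi_nhds.1 hv j) ?_
    simp only [Function.comp_apply, ← hTV, hu]
    exact tendsto_const_nhds
  refine ⟨φ, hφ, fun ε hε => ?_⟩
  choose δ hδ H using fun j : J => (hT j j.2).exists_solution_near (v j) hd (half_pos hε)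
  have hlimφ : Tendsto (fun n => ‖u (φ n)‖) atTop (𝓝 d) := hlim.comp hφ.tendsto_atTop
  have hev1 : ∀ᶠ n in atTop, ∀ j, ‖V (u (φ n)) j - v j‖ < δ j := by
    refine eventually_all.2 fun j => ?_
    filter_upwards [Metric.tendsto_nhds.1 (tendsto_pi_nhds.1 hv j) (δ j) (hδ j)] with n hn
    rwa [dist_eq_norm] at hn
  have hev2 : ∀ᶠ n in atTop, ∀ j, ‖u (φ n)‖ < d + δ j :=
    eventually_all.2 fun j => hlimφ.eventually (gt_mem_nhds (lt_add_of_pos_right d (hδ j)))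
  filter_upwards [hev1, hev2, hlimφ.eventually (gt_mem_nhds (lt_add_of_pos_right d (half_pos hε)))]
    with n h1 h2 h3
  set a := u (φ n)
  choose w hwT hwn hwε using fun j : J => H j (c0Sum.proj E j a) (h1 j)
    ((c0Sum.norm_proj_apply_le _ _).trans_lt (h2 j))
  set c := d / max d ‖a‖
  let b : ∀ i, E i := fun i => if h : i ∈ J then w ⟨i, h⟩ - c • c0Sum.proj E i a else 0
  -- A global multiple of `a` plus finitely many corrections, so that `W` lies in the `c₀`-sum by
  -- construction; `b` turns its coordinates in `J` into `w`.
  let W : c0Sum E := c • a + ∑ j ∈ J, c0Sum.incl E j (b j)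
  have hWmem (j : J) : c0Sum.proj E j W = w j := by
    simp only [W, map_add, map_smul, c0Sum.proj_sum_incl, if_pos j.2, b, dif_pos j.2]
    abel
  have hWnot {i : I} (hi : i ∉ J) : c0Sum.proj E i W = c • c0Sum.proj E i a := by
    simp only [W, map_add, map_smul, c0Sum.proj_sum_incl, if_neg hi, add_zero]
  have hrad (i : I) := norm_sub_smul_div_max_le (c0Sum.proj E i a) hd (r := ‖a‖)
    ((c0Sum.norm_proj_apply_le _ _).trans (le_max_right _ _))
  refine ⟨W, ?_, c0Sum.norm_le_of_forall_le hd.le fun i => ?_, lt_of_le_of_lt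
    (c0Sum.norm_le_of_forall_le (half_pos hε).le fun i => ?_) (half_lt_self hε)⟩
  · rw [hTV, ← hvsum]
    refine Finset.sum_congr rfl fun j _ => ?_
    simp only [V, hWmem]
    exact hwT j
  · by_cases hi : i ∈ J
    · rw [hWmem ⟨i, hi⟩]
      exact hwn _
    · rw [hWnot hi]
      exact (hrad i).1
  · rw [map_sub]
    by_cases hi : i ∈ J
    · rw [hWmem ⟨i, hi⟩]
      exact (hwε ⟨i, hi⟩).le
    · rw [hWnot hi]
      refine (hrad i).2.trans ?_
      rw [sub_le_iff_le_add, max_le_iff]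
      constructor <;> linarith

end KernelsInC0Sum

theorem mainTheorem7 {I : Type*} (E : I → Type*) [∀ i, NormedAddCommGroup (E i)]
    [∀ i, NormedSpace ℝ (E i)] [∀ i, CompleteSpace (E i)]
    (hE : ∀ i, SSDKernelsStronglyProximinal (E i)) :
    SSDKernelsStronglyProximinal (c0Sum E) := by
  classical
  intro S hS
  set T : c0Sum E →L[ℝ] (S → ℝ) := ContinuousLinearMap.pi fun f : S => (f : StrongDual ℝ (c0Sum E))
    with hTdef
  have hT : ⨅ f ∈ S, LinearMap.ker (f : c0Sum E →ₗ[ℝ] ℝ) =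
      LinearMap.ker (T : c0Sum E →ₗ[ℝ] (S → ℝ)) := by
    ext x
    simp [hTdef, funext_iff]
  rw [hT]
  have hfin : (⋃ f ∈ S, {i | f.comp (c0Sum.incl E i) ≠ 0}).Finite :=
    S.finite_toSet.biUnion fun f hf => (hS f hf).finite_comp_incl_ne_zero
  refine isStronglyProximinal_ker_of_finite T (J := hfin.toFinset) (fun i hi => ?_) fun i _ => ?_
  · ext a f
    by_contra hne
    refine hi (hfin.mem_toFinset.2 (Set.mem_biUnion f.2 fun h0 => hne ?_))
    exact DFunLike.congr_fun h0 a
  · have h := hE i (S.image fun f => f.comp (c0Sum.incl E i)) (by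
      simp only [Finset.mem_image, forall_exists_index, and_imp, forall_apply_eq_imp_iff₂]
      exact fun f hf => (hS f hf).comp_incl i)
    -- The kernel of the restriction of `T` to a summand is the intersection of the kernels of the
    -- components there.
    convert h using 1
    ext a
    simp [hTdef, funext_iff]
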